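/- Let $p$ be a prime and let $(a,b)$ be a two-part partition, i.e. $a\ge b>0$ are integers. Put $v=a+b$ and $[v]=\{1,\dots,v\}$, and write $\nu_p$ for the $p$-adic valuation. For a function $u$ from the set of all $b$-element subsets of $[v]$ to $\mathbb{F}_p$ and a subset $Z\subseteq[v]$ let $\hat u(Z)=\sum_{Y\supseteq Z}u(Y)$, the sum being over the $b$-element subsets $Y$ of $[v]$ that contain $Z$. For $j\le b$, the function $u$ is a ($p$-ary) $j$-design with coefficient $\mu_j\in\mathbb{F}_p$ if $\hat u(Z)=\mu_j$ for every $j$-element subset $Z$ of $[v]$; it is null as a $j$-design if $\mu_j=0$ and non-null as a $j$-design if $\mu_j\neq 0$. It is a universal design for $(a,b)$ if it is a $j$-design for all $0\le j<b$. **Theorem.** Suppose that $b=p^\beta+\hat b$ with integers $\beta\ge 0$ and $0\le\hat b<p^\beta$, and that $\hat b<p^{\nu_p(a+1)}<b$. (This holds in particular for every pointed partition, that is, whenever $b=p^\beta+\hat b$ and $\hat b<p^{\nu_p(a+1)}<p^\beta$.) Then there is a universal $p$-ary design $u$ for $(a,b)$ that is non-null only as a $\hat b$-design: $u$ is non-null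 as a $\hat b$-design, and it is null as a $j$-design for all $0\le j<b$ with $j\ne\hat b$. -/

import Mathlib

/-- `Block v s` is the collection of all subsets of a `v`-element set that have size `s`. -/
abbrev Block (v s : ℕ) : Type := {Y : Finset (Fin v) // Y.card = s}

/-- The function induced by `u` on subsets: `Z ↦ ∑ u Y` over all blocks `Y` containing `Z`. -/
def inducedFun {p v s : ℕ} (u : Block v s → ZMod p) (Z : Finset (Fin v)) : ZMod p :=
  ∑ Y : Block v s with Z ⊆ Y.1, u Y

/-- `u` is a `p`-ary `t`-design of constant block size `s` on a `v`-element set,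
with coefficient `μ`. -/
def IsDesignWithCoeff {p v s : ℕ} (u : Block v s → ZMod p) (t : ℕ) (μ : ZMod p) : Prop :=
  t ≤ s ∧ s ≤ v ∧ ∀ Z : Finset (Fin v), Z.card = t → inducedFun u Z = μ

/-- `u` is a `p`-ary `t`-design. -/
def IsDesign {p v s : ℕ} (u : Block v s → ZMod p) (t : ℕ) : Prop :=
  ∃ μ : ZMod p, IsDesignWithCoeff u t μ

/-- `u` is a null `t`-design: a `t`-design with coefficient zero. -/
def IsNullDesign {p v s : ℕ} (u : Block v s → ZMod p) (t : ℕ) : Prop :=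
  IsDesignWithCoeff u t 0

/-- `u` is a non-null `t`-design: a `t`-design with nonzero coefficient. -/
def IsNonNullDesign {p v s : ℕ} (u : Block v s → ZMod p) (t : ℕ) : Prop :=
  ∃ μ : ZMod p, μ ≠ 0 ∧ IsDesignWithCoeff u t μ

/-- `u` is a universal `p`-ary design for the partition `(a, b)`: it has block size `b` on a set
of `a + b` points and is a `j`-design for all `j < b`. -/
def IsUniversalDesign {p : ℕ} (a b : ℕ) (u : Block (a + b) b → ZMod p) : Prop :=
  ∀ j < b, IsDesign u j

/-- Among all `j < b`, the function `u` is non-null as a `t`-design and null as a `j`-design for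
every `j ≠ t`. -/
def IsNonNullOnlyAs {p : ℕ} (a b : ℕ) (u : Block (a + b) b → ZMod p) (t : ℕ) : Prop :=
  IsNonNullDesign u t ∧ ∀ j < b, j ≠ t → IsNullDesign u j

/-! Fix a set `T` of `2 * p ^ β - 1` points and let `u` indicate the blocks with at least `p ^ β`
points in `T`. Let `Z` have `b - k` points, `x` of them in `T`. If `x < p ^ β`, the row `2 * p ^ β -
1 - x` of Pascal's triangle is, modulo `p` and beyond column `p ^ β - 1 - x`, the row `p ^ β - 1 -
x` shifted by `p ^ β`; Vandermonde then gives `(a + k - p ^ β).choose (k - p ^ β)`, or `0` if `k < p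
^ β`. If `x ≥ p ^ β`, every block through `Z` counts, giving `(a + k).choose k`. As `a + 1` is
divisible by a power of `p` above `bhat`, only `k = p ^ β`, that is `Z.card = bhat`, survives. -/

open Finset in
/-- Counting the blocks through `Z` according to the way in which they meet `T`. -/
theorem sum_block_eq_sum_antidiagonal {p v b k : ℕ} (T Z : Finset (Fin v)) (g : ℕ → ZMod p)
    (hk : Z.card + k = b) :
    ∑ Y : Block v b with Z ⊆ Y.1, g (Y.1 ∩ T).card =
      ∑ x ∈ HasAntidiagonal.antidiagonal k, ((T \ Z).card.choose x.1 : ZMod p) * ((Tᶜ \ Z).card.choose x.2) *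
        g ((Z ∩ T).card + x.1) := by
  have h1 : ∀ x ∈ HasAntidiagonal.antidiagonal k,
      ((T \ Z).card.choose x.1 : ZMod p) * ((Tᶜ \ Z).card.choose x.2) * g ((Z ∩ T).card + x.1) =
      ∑ _q ∈ powersetCard x.1 (T \ Z) ×ˢ powersetCard x.2 (Tᶜ \ Z), g ((Z ∩ T).card + x.1) := by
    intro x _
    rw [sum_const, card_product, card_powersetCard, card_powersetCard, nsmul_eq_mul, Nat.cast_mul]
  rw [sum_congr rfl h1, sum_sigma']
  symm
  have hmem : ∀ c : (_ : ℕ × ℕ) × (Finset (Fin v) × Finset (Fin v)),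
      c ∈ (HasAntidiagonal.antidiagonal k).sigma
        (fun x => powersetCard x.1 (T \ Z) ×ˢ powersetCard x.2 (Tᶜ \ Z)) →
      c.1.1 + c.1.2 = k ∧ c.2.1 ⊆ T \ Z ∧ c.2.1.card = c.1.1 ∧ c.2.2 ⊆ Tᶜ \ Z ∧
        c.2.2.card = c.1.2 := by
    intro c hc
    simp only [mem_sigma, HasAntidiagonal.mem_antidiagonal, mem_product, mem_powersetCard] at hc
    tauto
  -- The traces on `T \ Z` and `Tᶜ \ Z` recover `A` and `B` from the block, which makes the
  -- correspondence bijective.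
  have hrec : ∀ A B : Finset (Fin v), A ⊆ T \ Z → B ⊆ Tᶜ \ Z →
      (Z ∪ A ∪ B) ∩ (T \ Z) = A ∧ (Z ∪ A ∪ B) ∩ (Tᶜ \ Z) = B ∧
        (Z ∪ A ∪ B) ∩ T = Z ∩ T ∪ A ∧ Disjoint Z A ∧ Disjoint (Z ∪ A) B ∧
        Disjoint (Z ∩ T) A := by
    intro A B hA hB
    simp only [subset_iff, mem_sdiff, mem_compl, disjoint_left, Finset.ext_iff, mem_union,
      mem_inter] at *
    refine ⟨fun x => ?_, fun x => ?_, fun x => ?_, fun x => ?_, fun x => ?_, fun x => ?_⟩ <;>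
    · have := @hA x
      have := @hB x
      tauto
  refine sum_bij (fun c hc => ⟨Z ∪ c.2.1 ∪ c.2.2, ?_⟩) ?_ ?_ ?_ ?_
  · obtain ⟨h, hA, hA', hB, hB'⟩ := hmem c hc
    obtain ⟨-, -, -, d1, d2, -⟩ := hrec _ _ hA hB
    rw [card_union_of_disjoint d2, card_union_of_disjoint d1]
    omega
  · intro c hc
    rw [mem_filter]
    exact ⟨mem_univ _, subset_union_left.trans subset_union_left⟩
  · rintro ⟨⟨m, l⟩, A, B⟩ hc ⟨⟨m', l'⟩, A', B'⟩ hc' h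
    obtain ⟨-, hA, hm, hB, hl⟩ := hmem _ hc
    obtain ⟨-, hA', hm', hB', hl'⟩ := hmem _ hc'
    dsimp only at hA hm hB hl hA' hm' hB' hl'
    subst hm hl hm' hl'
    have h' : Z ∪ A ∪ B = Z ∪ A' ∪ B' := congrArg Subtype.val h
    obtain ⟨e1, e2, -⟩ := hrec _ _ hA hB
    obtain ⟨e1', e2', -⟩ := hrec _ _ hA' hB'
    have hAA : A = A' := by
      rw [h'] at e1
      exact e1.symm.trans e1'
    have hBB : B = B' := by
      rw [h'] at e2
      exact e2.symm.trans e2'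
    subst hAA hBB
    rfl
  · intro Y hY
    rw [mem_filter] at hY
    have hU : Z ∪ Y.1 ∩ (T \ Z) ∪ Y.1 ∩ (Tᶜ \ Z) = Y.1 := by
      ext x
      have := @hY.2 x
      simp only [mem_union, mem_inter, mem_sdiff, mem_compl]
      tauto
    obtain ⟨-, -, -, d1, d2, -⟩ := hrec (Y.1 ∩ (T \ Z)) (Y.1 ∩ (Tᶜ \ Z))
      inter_subset_right inter_subset_right
    have hc := congrArg card hU
    rw [card_union_of_disjoint d2, card_union_of_disjoint d1, Y.2] at hc
    refine ⟨⟨((Y.1 ∩ (T \ Z)).card, (Y.1 ∩ (Tᶜ \ Z)).card), Y.1 ∩ (T \ Z), Y.1 ∩ (Tᶜ \ Z)⟩,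
      ?_, Subtype.ext hU⟩
    simp only [mem_sigma, HasAntidiagonal.mem_antidiagonal, mem_product, mem_powersetCard, inter_subset_right,
      and_true]
    omega
  · intro c hc
    obtain ⟨-, hA, hA', hB, -⟩ := hmem c hc
    obtain ⟨-, -, e, -, -, d⟩ := hrec _ _ hA hB
    simp only [e, card_union_of_disjoint d, hA']

/-- Binomial coefficients `(a + k).choose k` vanish modulo `p` for small positive `k` if `a + 1`
is divisible by a large power of `p`. -/
theorem cast_add_choose_eq_zero {p n a k : ℕ} [Fact p.Prime] (h : p ^ n ∣ a + 1) (hk : 0 < k)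
    (hkn : k < p ^ n) : ((a + k).choose k : ZMod p) = 0 := by
  rw [ZMod.natCast_eq_zero_iff]
  obtain ⟨k, rfl⟩ := Nat.exists_eq_succ_of_ne_zero hk.ne'
  -- The absorption identity brings in the factor `a + 1`; a binomial prime to `p` would force `p ^
  -- n ∣ k + 1`.
  have h1 := Nat.choose_succ_right_eq (a + (k + 1)) k
  rw [show a + (k + 1) - k = a + 1 by omega] at h1
  by_contra hp
  have hc : Nat.Coprime (p ^ n) ((a + (k + 1)).choose (k + 1)) :=
    Nat.Coprime.pow_left _ ((Fact.out : p.Prime).coprime_iff_not_dvd.mpr hp)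
  have h2 : p ^ n ∣ (a + (k + 1)).choose (k + 1) * (k + 1) := h1 ▸ h.mul_left _
  exact absurd (Nat.le_of_dvd k.succ_pos (hc.dvd_of_dvd_mul_left h2)) (not_le.mpr hkn)

/-- The top half of the row `p ^ β + n` of Pascal's triangle modulo `p`. -/
theorem cast_pow_add_choose {p β n m : ℕ} [Fact p.Prime] (hm : n < m) :
    ((p ^ β + n).choose m : ZMod p) = if p ^ β ≤ m then (n.choose (m - p ^ β) : ZMod p) else 0 := by
  rw [Nat.add_choose_eq, Nat.cast_sum]
  have hz : ∀ x ∈ Finset.HasAntidiagonal.antidiagonal m, x.1 ≠ p ^ β →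
      (((p ^ β).choose x.1 * n.choose x.2 : ℕ) : ZMod p) = 0 := by
    intro x hx hne
    rw [Finset.HasAntidiagonal.mem_antidiagonal] at hx
    rcases Nat.eq_zero_or_pos x.1 with h0 | h0
    · rw [Nat.choose_eq_zero_of_lt (show n < x.2 by omega), mul_zero, Nat.cast_zero]
    · rw [ZMod.natCast_eq_zero_iff]
      exact ((Fact.out : p.Prime).dvd_choose_pow h0.ne' hne).mul_right _
  split_ifs with h
  · rw [Finset.sum_eq_single_of_mem (p ^ β, m - p ^ β)
      (Finset.HasAntidiagonal.mem_antidiagonal.mpr (by simp only; omega))]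
    · simp
    · intro x hx hne
      refine hz x hx fun he => hne ?_
      rw [Finset.HasAntidiagonal.mem_antidiagonal] at hx
      exact Prod.ext he (by simp only; omega)
  · refine Finset.sum_eq_zero fun x hx => hz x hx ?_
    rw [Finset.HasAntidiagonal.mem_antidiagonal] at hx
    omega

/-- Vandermonde's identity for the terms in the upper part of a row `2 p ^ β - 1 - x`. -/
theorem sum_antidiagonal_choose_of_lt {p β x r k : ℕ} [Fact p.Prime] (hx : x < p ^ β) :
    ∑ y ∈ Finset.HasAntidiagonal.antidiagonal k, ((2 * p ^ β - 1 - x).choose y.1 : ZMod p) * (r.choose y.2) *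
        (if p ^ β ≤ x + y.1 then 1 else 0) =
      if p ^ β ≤ k then ((p ^ β - 1 - x + r).choose (k - p ^ β) : ZMod p) else 0 := by
  have hterm : ∀ y ∈ Finset.HasAntidiagonal.antidiagonal k,
      ((2 * p ^ β - 1 - x).choose y.1 : ZMod p) * (r.choose y.2) *
        (if p ^ β ≤ x + y.1 then 1 else 0) =
      if p ^ β ≤ y.1 then ((p ^ β - 1 - x).choose (y.1 - p ^ β) : ZMod p) * (r.choose y.2)
        else 0 := by
    intro y _
    -- The threshold puts `y.1` beyond column `p ^ β - 1 - x`, as the shift requires; below it, `y.1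
    -- < p ^ β` and both sides vanish.
    by_cases h : p ^ β ≤ x + y.1
    · rw [if_pos h, mul_one, show 2 * p ^ β - 1 - x = p ^ β + (p ^ β - 1 - x) by omega,
        cast_pow_add_choose (by omega), ite_mul, zero_mul]
    · rw [if_neg h, mul_zero, if_neg (by omega)]
  rw [Finset.sum_congr rfl hterm]
  split_ifs with hk
  · obtain ⟨k, rfl⟩ := Nat.exists_eq_add_of_le hk
    rw [Nat.add_sub_cancel_left, Nat.add_choose_eq, Nat.cast_sum, ← Finset.sum_filter]
    symm
    refine Finset.sum_bij (fun y _ => (p ^ β + y.1, y.2)) ?_ ?_ ?_ ?_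
    · intro y hy
      rw [Finset.HasAntidiagonal.mem_antidiagonal] at hy
      rw [Finset.mem_filter, Finset.HasAntidiagonal.mem_antidiagonal]
      exact ⟨by simp only; omega, by simp only; omega⟩
    · intro y _ z _ h
      rw [Prod.mk.injEq] at h
      exact Prod.ext (by omega) h.2
    · intro y hy
      rw [Finset.mem_filter, Finset.HasAntidiagonal.mem_antidiagonal] at hy
      exact ⟨(y.1 - p ^ β, y.2), Finset.HasAntidiagonal.mem_antidiagonal.mpr (by simp only; omega),
        Prod.ext (by simp only; omega) rfl⟩
    · intro y _
      simp
  · refine Finset.sum_eq_zero fun y hy => if_neg ?_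
    rw [Finset.HasAntidiagonal.mem_antidiagonal] at hy
    omega

/-- The blocks meeting a fixed set of `2 p ^ β - 1` points in at least `p ^ β` points. -/
theorem inducedFun_indicator {p a b β bhat n : ℕ} [Fact p.Prime] (hb : b = p ^ β + bhat)
    (hβ : bhat < p ^ β)
    (ha : p ^ n ∣ a + 1) (hn : bhat < p ^ n) {T Z : Finset (Fin (a + b))}
    (hT : T.card = 2 * p ^ β - 1) (hZ : Z.card < b) :
    inducedFun (fun Y : Block (a + b) b => if p ^ β ≤ (Y.1 ∩ T).card then (1 : ZMod p) else 0) Z =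
      if Z.card = bhat then 1 else 0 := by
  obtain ⟨k, hk⟩ := Nat.exists_eq_add_of_le hZ.le
  unfold inducedFun
  rw [sum_block_eq_sum_antidiagonal T Z (fun i => if p ^ β ≤ i then 1 else 0) hk.symm]
  have h1 := Finset.card_sdiff_add_card_inter T Z
  have h2 := Finset.card_sdiff_add_card_inter Tᶜ Z
  have h3 := Finset.card_inter_add_card_sdiff Z T
  have h4 : Tᶜ ∩ Z = Z \ T := by
    ext x
    simp only [Finset.mem_inter, Finset.mem_compl, Finset.mem_sdiff]
    tauto
  have h5 := Finset.card_add_card_compl T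
  rw [Fintype.card_fin] at h5
  rw [h4] at h2
  rw [Finset.inter_comm] at h1
  have hP : 0 < p ^ β := pow_pos (Fact.out : p.Prime).pos β
  rcases lt_or_ge (Z ∩ T).card (p ^ β) with hx | hx
  · rw [show (T \ Z).card = 2 * p ^ β - 1 - (Z ∩ T).card by omega,
      sum_antidiagonal_choose_of_lt hx]
    rcases lt_trichotomy k (p ^ β) with h | rfl | h
    · rw [if_neg (by omega), if_neg (by omega)]
    · rw [if_pos le_rfl, if_pos (by omega), Nat.sub_self, Nat.choose_zero_right, Nat.cast_one]
    -- Here `0 < k - p ^ β ≤ bhat`, within reach of the divisibility of `a + 1`.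
    · rw [if_pos h.le, if_neg (by omega),
        show p ^ β - 1 - (Z ∩ T).card + (Tᶜ \ Z).card = a + (k - p ^ β) by omega]
      exact cast_add_choose_eq_zero ha (by omega) (by omega)
  -- Now `Z.card ≥ p ^ β`, so `0 < k ≤ bhat`; writing `0` as `(a + k).choose k` turns the goal into
  -- Vandermonde.
  · rw [if_neg (by omega), ← cast_add_choose_eq_zero ha (show 0 < k by omega) (by omega),
      show a + k = (T \ Z).card + (Tᶜ \ Z).card by omega, Nat.add_choose_eq, Nat.cast_sum]
    refine Finset.sum_congr rfl fun y _ => ?_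
    rw [if_pos (hx.trans (Nat.le_add_right _ _)), mul_one, Nat.cast_mul]

theorem mainTheorem2 (p : ℕ) [Fact p.Prime] (a b β bhat : ℕ)
    (hab : b ≤ a) (hb : b = p ^ β + bhat) (hβ : bhat < p ^ β)
    (h₁ : bhat < p ^ padicValNat p (a + 1)) (h₂ : p ^ padicValNat p (a + 1) < b) :
    ∃ u : Block (a + b) b → ZMod p, IsUniversalDesign a b u ∧ IsNonNullOnlyAs a b u bhat := by
  -- There is room for `T` because `p ^ β ≤ b ≤ a`.
  obtain ⟨T, -, hT⟩ := Finset.exists_subset_card_eq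
    (show 2 * p ^ β - 1 ≤ (Finset.univ : Finset (Fin (a + b))).card by
      rw [Finset.card_fin]; omega)
  have key : ∀ j < b, IsDesignWithCoeff
      (fun Y : Block (a + b) b => if p ^ β ≤ (Y.1 ∩ T).card then (1 : ZMod p) else 0) j
      (if j = bhat then 1 else 0) := by
    intro j hj
    refine ⟨hj.le, Nat.le_add_left b a, ?_⟩
    rintro Z rfl
    exact inducedFun_indicator hb hβ pow_padicValNat_dvd h₁ hT hj
  refine ⟨_, fun j hj => ⟨_, key j hj⟩, ⟨1, one_ne_zero, ?_⟩, fun j hj hne => ?_⟩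
  · have := key bhat (by omega)
    rwa [if_pos rfl] at this
  · have := key j hj
    rwa [if_neg hne] at this
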